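/- Let $\Gamma$ be a finite simple graph with vertex set $\{1,\dots,N\}$ and let $A$ be the right-angled Artin group with generators $a_1,\dots,a_N$ and relations $a_ia_j=a_ja_i$ for all $i,j$ that are \emph{not} joined by an edge of $\Gamma$; below, "$a_i$ and $a_j$ do not commute" means that $i,j$ are joined by an edge. \textbf{Words.} Words are over the letters $a_i^{\pm1}$; two words are equivalent if they represent the same element of $A$. A word is \emph{reduced} if it has no subword $a_i^{\varepsilon}xa_i^{-\varepsilon}$ ($\varepsilon=\pm1$) in which all letters of $x$ commute with $a_i$. It is \emph{cyclically reduced} if every word obtained from it by a (possibly empty) sequence of cyclings (moving the first letter to the end) and commutations of neighbouring commuting letters is reduced. A reduced word is \emph{initially normal} if it is empty or the index of its first letter is at least the index of the first letter of every equivalent reduced word; a reduced word is \emph{normal} if all its suffixes are initially normal. A \emph{cyclic normal form} is a reduced, cyclically reduced word that is normal and all of whose cyclic conjugates (cyclic permutations) are normal. \textbf{Pilings.} An abstract piling is a family of $N$ words (the $a_i$-stacks, read from bottom to top) over $\{+,-,0\}$. For a word $w$, the abstract piling $\pi^\star(w)$ is built from the empty one by reading $w$ from left to right. When $a_i^{\varepsilon}$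 is read: if the $a_i$-stack does not end with the sign $-\varepsilon$, append the sign of $\varepsilon$ to the $a_i$-stack and $0$ to the $a_j$-stack for every $a_j$ that does not commute with $a_i$; if it ends with $-\varepsilon$, erase the last letter of the $a_i$-stack and of all those $a_j$-stacks. A \emph{piling} is an abstract piling of the form $\pi^\star(w)$. A piling $p$ is \emph{non-split} if the full subgraph of $\Gamma$ on the vertices $i$ whose stack contains a letter $+$ or $-$ is non-empty and connected. It is \emph{cyclically reduced} if no stack starts with $+$ and ends with $-$, or vice versa. It is \emph{pyramidal} if some stack contains a letter $+$ or $-$ and, $i$ being the smallest index of such a stack, every $a_j$-stack with $j\neq i$ is empty or starts with $0$. The word $\sigma^\star(p)$ is defined recursively: it is empty if $p$ is empty; otherwise let $i$ be the largest index such that the $a_i$-stack starts with $+$ or $-$, and put $\sigma^\star(p)=a_i^{\pm1}\sigma^\star(p_1)$, with exponent given by that sign, where $p_1$ is obtained from $p$ by removing the first letter of the $a_i$-stack and of the $a_j$-stack for every $a_j$ that does not commute with $a_i$. \textbf{Proposition.} If $p$ is a non-split, cyclically reduced, pyramidal piling, then the word $\sigma^\star(p)$ is a cyclic normal form; that is,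 it is reduced and cyclically reduced, it is normal, and all its cyclic conjugates are normal. -/

import Mathlib

namespace RAAG

/-- The right-angled Artin group on generators `a_i`, `i : Fin N`, defined by the simple graph `Γ`
with the convention that two generators commute exactly when they are NOT joined by an edge. -/
abbrev ArtinGroup {N : ℕ} (Γ : SimpleGraph (Fin N)) : Type :=
  PresentedGroup {r : FreeGroup (Fin N) |
    ∃ i j : Fin N, ¬ Γ.Adj i j ∧
      r = FreeGroup.of i * FreeGroup.of j * (FreeGroup.of i)⁻¹ * (FreeGroup.of j)⁻¹}

/-- A letter: `(i, true)` is `a_i`, and `(i, false)` is the inverse of `a_i`. -/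
abbrev Letter (N : ℕ) : Type := Fin N × Bool

/-- Words over the letters and their inverses. -/
abbrev Word (N : ℕ) : Type := List (Letter N)

/-- The element of the right-angled Artin group represented by a word. -/
def toGroup {N : ℕ} (Γ : SimpleGraph (Fin N)) (w : Word N) : ArtinGroup Γ :=
  PresentedGroup.mk _ (FreeGroup.mk w)

/-- A word is reduced if it has no subword `a_i^ε x a_i^{-ε}` such that all letters of `x` commute
with `a_i`. -/
def IsReduced {N : ℕ} (Γ : SimpleGraph (Fin N)) (w : Word N) : Prop :=
  ¬ ∃ (u x v : Word N) (i : Fin N) (e : Bool),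
    w = u ++ (i, e) :: x ++ (i, !e) :: v ∧ ∀ c ∈ x, ¬ Γ.Adj i c.1

/-- A reduced word is initially normal if it is trivial or the index of its first letter is at least
the index of the first letter of any equivalent reduced word. -/
def IsInitiallyNormal {N : ℕ} (Γ : SimpleGraph (Fin N)) (w : Word N) : Prop :=
  IsReduced Γ w ∧
    ∀ u : Word N, IsReduced Γ u → toGroup Γ u = toGroup Γ w →
      ∀ a ∈ w.head?, ∀ b ∈ u.head?, b.1 ≤ a.1

/-- A reduced word is normal if all its suffixes are initially normal. -/
def IsNormal {N : ℕ} (Γ : SimpleGraph (Fin N)) (w : Word N) : Prop :=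
  IsReduced Γ w ∧ ∀ v : Word N, v <:+ w → IsInitiallyNormal Γ v

/-- One elementary move on words: a cycling (the first letter is moved to the end) or a commutation
of two neighbouring letters. -/
inductive Move {N : ℕ} (Γ : SimpleGraph (Fin N)) : Word N → Word N → Prop
  | cycling (a : Letter N) (w : Word N) : Move Γ (a :: w) (w ++ [a])
  | commutation (u v : Word N) (a b : Letter N) (h : ¬ Γ.Adj a.1 b.1) :
      Move Γ (u ++ a :: b :: v) (u ++ b :: a :: v)

/-- A word is cyclically reduced if it is reduced and all words obtained from it by a sequence of
cyclings and commutations are reduced (the empty sequence gives the word itself). -/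
def IsCyclicallyReducedWord {N : ℕ} (Γ : SimpleGraph (Fin N)) (w : Word N) : Prop :=
  ∀ v : Word N, Relation.ReflTransGen (Move Γ) w v → IsReduced Γ v

/-- A cyclic normal form: a reduced and cyclically reduced word which is normal and all of whose
cyclic conjugates are normal. -/
def IsCyclicNormalForm {N : ℕ} (Γ : SimpleGraph (Fin N)) (w : Word N) : Prop :=
  IsReduced Γ w ∧ IsCyclicallyReducedWord Γ w ∧ IsNormal Γ w ∧
    ∀ v : Word N, v ~r w → IsNormal Γ v

/-- An abstract piling: for each generator a stack, that is, a word over the alphabet `{+, -, 0}`,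
here `SignType = {1, -1, 0}`. The head of the list is the bottom of the stack. -/
abbrev AbstractPiling (N : ℕ) : Type := Fin N → List SignType

/-- The bead on its own stick of a letter. -/
def bead : Bool → SignType
  | true => 1
  | false => -1

/-- The effect of reading one letter `a = a_i^ε`. If the `a_i`-stack ends with `-ε`, the last beads
of the `a_i`-stack and of the stacks of all generators that do not commute with `a_i` are erased.
Otherwise `ε` is appended to the `a_i`-stack and `0` to the stacks of all generators that do not
commute with `a_i`. -/
def addLetter {N : ℕ} (Γ : SimpleGraph (Fin N)) [DecidableRel Γ.Adj]
    (p : AbstractPiling N) (a : Letter N) : AbstractPiling N :=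
  if (p a.1).getLast? = some (-bead a.2) then
    fun j => if j = a.1 ∨ Γ.Adj a.1 j then (p j).dropLast else p j
  else
    fun j => if j = a.1 then p j ++ [bead a.2] else if Γ.Adj a.1 j then p j ++ [0] else p j

/-- The map `π*` from words to abstract pilings. -/
def piStar {N : ℕ} (Γ : SimpleGraph (Fin N)) [DecidableRel Γ.Adj] (w : Word N) :
    AbstractPiling N :=
  w.foldl (addLetter Γ) (fun _ => [])

/-- A piling is an abstract piling in the image of `π*`. -/
def IsPiling {N : ℕ} (Γ : SimpleGraph (Fin N)) [DecidableRel Γ.Adj]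
    (p : AbstractPiling N) : Prop :=
  ∃ w : Word N, piStar Γ w = p

/-- The set of indices `i` such that the `a_i`-stack contains a bead `+` or `-`. -/
def support {N : ℕ} (p : AbstractPiling N) : Set (Fin N) :=
  {i | ∃ s ∈ p i, s ≠ 0}

/-- A piling is non-split if the full subgraph of `Γ` on its support is connected (in particular
the piling is not trivial). -/
def IsNonSplit {N : ℕ} (Γ : SimpleGraph (Fin N)) (p : AbstractPiling N) : Prop :=
  (Γ.induce (support p)).Connected

/-- No cyclic reduction is possible: no stack starts with `+` and ends with `-`, or vice versa. -/
def IsCyclicallyReduced {N : ℕ} (p : AbstractPiling N) : Prop :=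
  ¬ ∃ (i : Fin N) (s : SignType),
    s ≠ 0 ∧ (p i).head? = some s ∧ (p i).getLast? = some (-s)

/-- A piling is pyramidal if, `i` being the smallest index whose stack contains a bead `+` or `-`,
every stack other than the `a_i`-stack is empty or starts with `0`. -/
def IsPyramidal {N : ℕ} (p : AbstractPiling N) : Prop :=
  ∃ i : Fin N, IsLeast (support p) i ∧ ∀ j : Fin N, j ≠ i → p j = [] ∨ (p j).head? = some 0

/-- The indices of the stacks that start with `+` or `-`. -/
def bottom {N : ℕ} (p : AbstractPiling N) : Finset (Fin N) :=
  Finset.univ.filter fun i => (p i).head? = some 1 ∨ (p i).head? = some (-1)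

/-- Removal of the bottom `a_i`-tile: the first bead is removed from the `a_i`-stack and from the
stacks of all generators that do not commute with `a_i`. -/
def removeBottom {N : ℕ} (Γ : SimpleGraph (Fin N)) [DecidableRel Γ.Adj]
    (p : AbstractPiling N) (i : Fin N) : AbstractPiling N :=
  fun j => if j = i ∨ Γ.Adj i j then (p j).tail else p j

/-- The number of beads `+` and `-`. -/
def size {N : ℕ} (p : AbstractPiling N) : ℕ :=
  ∑ i, (p i).countP (fun s => s ≠ 0)

theorem size_removeBottom_lt {N : ℕ} (Γ : SimpleGraph (Fin N)) [DecidableRel Γ.Adj]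
    (p : AbstractPiling N) (i : Fin N) (hi : i ∈ bottom p) :
    size (removeBottom Γ p i) < size p := by
  unfold size
  refine Finset.sum_lt_sum (fun j _ => ?_) ⟨i, Finset.mem_univ i, ?_⟩
  · unfold removeBottom
    split
    · exact (List.tail_sublist _).countP_le
    · exact le_rfl
  · simp only [bottom, Finset.mem_filter] at hi
    simp only [removeBottom, true_or, if_true]
    cases h : p i with
    | nil => simp [h] at hi
    | cons s l =>
      have hs : s ≠ 0 := by
        rw [h] at hi
        rcases hi.2 with h1 | h1 <;> simp at h1 <;> rw [h1] <;> decide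
      simp [hs]

/-- The word `σ*(p)` read off from `p`: as long as possible, take the largest index `i` such that
the `a_i`-stack starts with `+` or `-`, write the corresponding letter, and remove the bottom
`a_i`-tile. -/
def sigmaStar {N : ℕ} (Γ : SimpleGraph (Fin N)) [DecidableRel Γ.Adj]
    (p : AbstractPiling N) : Word N :=
  if h : (bottom p).Nonempty then
    ((bottom p).max' h, decide ((p ((bottom p).max' h)).head? = some 1)) ::
      sigmaStar Γ (removeBottom Γ p ((bottom p).max' h))
  else []
termination_by size p
decreasing_by exact size_removeBottom_lt Γ p _ (Finset.max'_mem _ h)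

end RAAG

/-!
Without cancellation, the letters of a word `w` stack up to a family of stacks, and `w` is reduced
exactly when no stack has two consecutive opposite signs. Hence every piling is the stack family of
a reduced word. Reading a letter and then its inverse does nothing to such a family, and commuting
letters can be read in either order, so the group acts on pilings and equivalent reduced words have
equal stacks. In particular the first letter of a word equivalent to a reduced word `w` sits at the
bottom of its stack in the piling of `w`, which makes the greedy word `σ*(p)` normal. If `p` is
pyramidal, the letter of smallest index is the only one at the bottom, so cutting the greedy word
anywhere and exchanging the two pieces gives a greedy word again. Finally, the stacks read
cyclically have no consecutive opposite signs, and cyclings and commutations preserve this property.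
-/

namespace RAAG

theorem bead_ne_zero (e : Bool) : bead e ≠ 0 := by cases e <;> decide

theorem bead_injective : Function.Injective bead := by decide

theorem neg_bead (e : Bool) : -bead e = bead !e := by cases e <;> decide

theorem exists_bead_eq {s : SignType} (hs : s ≠ 0) : ∃ e, bead e = s := by
  revert s
  decide

/-- Two beads are compatible if they are not opposite signs: these are the pairs of beads that may
be consecutive in a stack of a reduced word. -/
def Compatible (s t : SignType) : Prop := s * t ≠ -1

theorem not_compatible_iff {s t : SignType} :
    ¬ Compatible s t ↔ ∃ e, s = bead e ∧ t = bead !e := by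
  unfold Compatible
  revert s t
  decide

theorem Compatible.eq_of_ne_zero {s t : SignType} (h : Compatible s t) (hs : s ≠ 0)
    (ht : t ≠ 0) : s = t := by
  unfold Compatible at h
  revert s t
  decide

theorem mem_bottom_iff {N : ℕ} {p : AbstractPiling N} {i : Fin N} :
    i ∈ bottom p ↔ ∃ e, (p i).head? = some (bead e) := by
  simp only [bottom, Finset.mem_filter, Finset.mem_univ, true_and, Bool.exists_bool, bead, or_comm]

theorem IsPyramidal.le_of_mem_bottom_of_mem_support {N : ℕ} {p : AbstractPiling N}
    (hp : IsPyramidal p) {j k : Fin N} (hk : k ∈ bottom p) (hj : j ∈ support p) : k ≤ j := by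
  obtain ⟨i, hi, hother⟩ := hp
  obtain ⟨e, he⟩ := mem_bottom_iff.1 hk
  have hki : k = i := by
    by_contra hne
    rcases hother k hne with h | h
    · simp [h] at he
    · exact bead_ne_zero e (Option.some.inj (he.symm.trans h))
  exact hki ▸ hi.2 hj

section Words

variable {N : ℕ} {Γ : SimpleGraph (Fin N)}

theorem IsReduced.of_infix {u w : Word N} (hw : IsReduced Γ w) (h : u <:+: w) :
    IsReduced Γ u := by
  obtain ⟨s, t, rfl⟩ := h
  rintro ⟨u, x, v, i, e, rfl, hx⟩
  exact hw ⟨s ++ u, x, v ++ t, i, e, by simp, hx⟩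

theorem toGroup_append (u v : Word N) : toGroup Γ (u ++ v) = toGroup Γ u * toGroup Γ v := by
  rw [toGroup, ← FreeGroup.mul_mk, map_mul, toGroup, toGroup]

theorem toGroup_singleton_false (i : Fin N) :
    toGroup Γ [(i, false)] = (toGroup Γ [(i, true)])⁻¹ := by
  rw [toGroup, toGroup, ← map_inv, FreeGroup.inv_mk]
  rfl

theorem reflTransGen_move_of_isRotated {v w : Word N} (h : v ~r w) :
    Relation.ReflTransGen (Move Γ) v w := by
  obtain ⟨n, rfl⟩ := h
  induction n generalizing v with
  | zero => rw [List.rotate_zero]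
  | succ n ih =>
    cases v with
    | nil => rw [List.rotate_nil]
    | cons a v => exact List.rotate_cons_succ v a n ▸ ih.head (Move.cycling a v)

end Words

variable {N : ℕ} (Γ : SimpleGraph (Fin N)) [DecidableRel Γ.Adj]

/-- The bead, if any, that a letter puts on the `a_k`-stack when nothing is cancelled. -/
def mark (k : Fin N) (a : Letter N) : Option SignType :=
  if k = a.1 then some (bead a.2) else if Γ.Adj a.1 k then some 0 else none

/-- The abstract piling obtained from a word by letting its letters pile up without any
cancellation. It is the piling `π*` of the word when the word is reduced. -/
def pile (w : Word N) : AbstractPiling N := fun k => w.filterMap (mark Γ k)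

variable {Γ}

section Pile

variable {a b : Letter N} {k : Fin N} {e : Bool} {u v w x : Word N}

theorem mark_eq_none_iff : mark Γ k a = none ↔ ¬ (k = a.1 ∨ Γ.Adj a.1 k) := by
  unfold mark
  split_ifs with h₁ h₂ <;> simp [*]

theorem mark_eq_some_bead_iff : mark Γ k a = some (bead e) ↔ a = (k, e) := by
  unfold mark
  split_ifs with h₁ h₂
  · simp [Prod.ext_iff, h₁, bead_injective.eq_iff]
  · simp [Prod.ext_iff, (bead_ne_zero e).symm, Ne.symm h₁]
  · simp [Prod.ext_iff, Ne.symm h₁]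

theorem pile_append (u v : Word N) (k : Fin N) :
    pile Γ (u ++ v) k = pile Γ u k ++ pile Γ v k :=
  List.filterMap_append

theorem pile_cons_self (k : Fin N) (e : Bool) (w : Word N) :
    pile Γ ((k, e) :: w) k = bead e :: pile Γ w k :=
  List.filterMap_cons_some (mark_eq_some_bead_iff.2 rfl)

theorem pile_singleton (a : Letter N) (k : Fin N) : pile Γ [a] k = (mark Γ k a).toList := by
  rw [pile, List.filterMap_cons]
  cases mark Γ k a <;> rfl

theorem pile_singleton_of_not (h : ¬ (k = a.1 ∨ Γ.Adj a.1 k)) : pile Γ [a] k = [] :=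
  List.filterMap_cons_none (mark_eq_none_iff.2 h)

theorem pile_eq_nil_iff : pile Γ w k = [] ↔ ∀ a ∈ w, ¬ (k = a.1 ∨ Γ.Adj a.1 k) := by
  simp only [pile, List.filterMap_eq_nil_iff, mark_eq_none_iff]

theorem pile_append_congr {u' v' : Word N} (hu : pile Γ u = pile Γ u')
    (hv : pile Γ v = pile Γ v') :
    pile Γ (u ++ v) = pile Γ (u' ++ v') := by
  funext k
  rw [pile_append, pile_append, hu, hv]

theorem mem_support_pile_iff : k ∈ support (pile Γ w) ↔ ∃ e, (k, e) ∈ w := by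
  constructor
  · rintro ⟨s, hs, hs0⟩
    obtain ⟨e, rfl⟩ := exists_bead_eq hs0
    obtain ⟨a, ha, hae⟩ := List.mem_filterMap.1 hs
    exact ⟨e, mark_eq_some_bead_iff.1 hae ▸ ha⟩
  · rintro ⟨e, he⟩
    exact ⟨bead e, List.mem_filterMap.2 ⟨_, he, mark_eq_some_bead_iff.2 rfl⟩, bead_ne_zero e⟩

theorem mem_bottom_pile_append :
    k ∈ bottom (pile Γ (u ++ v)) ↔
      k ∈ bottom (pile Γ u) ∨ pile Γ u k = [] ∧ k ∈ bottom (pile Γ v) := by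
  simp only [mem_bottom_iff, pile_append]
  cases pile Γ u k <;> simp

theorem fst_mem_bottom_pile_cons (a : Letter N) (w : Word N) :
    a.1 ∈ bottom (pile Γ (a :: w)) :=
  mem_bottom_iff.2 ⟨a.2, congrArg List.head? (pile_cons_self a.1 a.2 w)⟩

theorem pile_pair_comm (hne : a.1 ≠ b.1) (hab : ¬ Γ.Adj a.1 b.1) :
    pile Γ [a, b] = pile Γ [b, a] := by
  have hba : ¬ Γ.Adj b.1 a.1 := fun h => hab h.symm
  funext k
  by_cases ha : k = a.1
  · simp [pile, mark, ha, hne, hba]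
  by_cases hb : k = b.1
  · simp [pile, mark, hb, hne.symm, hab]
  by_cases ha' : Γ.Adj a.1 k <;> by_cases hb' : Γ.Adj b.1 k <;>
    simp [pile, mark, ha, hb, ha', hb']

theorem pile_cons_eq_pile_append_singleton (hx : pile Γ x a.1 = []) :
    pile Γ (a :: x) = pile Γ (x ++ [a]) := by
  induction x with
  | nil => rfl
  | cons b x ih =>
    rw [pile_eq_nil_iff, List.forall_mem_cons, ← pile_eq_nil_iff, not_or] at hx
    obtain ⟨⟨hne, hba⟩, hx⟩ := hx
    calc pile Γ ([a, b] ++ x)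
        = pile Γ ([b, a] ++ x) :=
          pile_append_congr (pile_pair_comm hne fun hab => hba hab.symm) rfl
      _ = pile Γ ([b] ++ (x ++ [a])) := pile_append_congr (u := [b]) rfl (ih hx)

theorem exists_eq_append_of_pile_eq {l₁ l₂ : List SignType}
    (h : pile Γ w k = l₁ ++ bead e :: l₂) :
    ∃ x y, w = x ++ (k, e) :: y ∧ pile Γ x k = l₁ ∧ pile Γ y k = l₂ := by
  obtain ⟨u, v, rfl, hu, hv⟩ := List.filterMap_eq_append_iff.1 h
  obtain ⟨x, a, y, rfl, hx, ha, hy⟩ := List.filterMap_eq_cons_iff.1 hv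
  obtain rfl := mark_eq_some_bead_iff.1 ha
  have hx' : pile Γ x k = [] := List.filterMap_eq_nil_iff.2 hx
  exact ⟨u ++ x, y, by simp, by rw [pile_append, hx', List.append_nil]; exact hu, hy⟩

theorem exists_pile_eq_pile_cons (h : (pile Γ w k).head? = some (bead e)) :
    ∃ v, v.length < w.length ∧ pile Γ w = pile Γ ((k, e) :: v) := by
  obtain ⟨l, hl⟩ := List.head?_eq_some_iff.1 h
  obtain ⟨x, y, rfl, hx, -⟩ := exists_eq_append_of_pile_eq (l₁ := []) hl
  refine ⟨x ++ y, by simp, ?_⟩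
  calc pile Γ (x ++ (k, e) :: y)
      = pile Γ ((x ++ [(k, e)]) ++ y) := by rw [List.append_assoc, List.singleton_append]
    _ = pile Γ ((k, e) :: x ++ y) :=
      pile_append_congr (pile_cons_eq_pile_append_singleton hx).symm rfl

theorem exists_pile_eq_pile_append_singleton (h : (pile Γ w k).getLast? = some (bead e)) :
    ∃ v, pile Γ w = pile Γ (v ++ [(k, e)]) := by
  obtain ⟨l, hl⟩ := List.getLast?_eq_some_iff.1 h
  obtain ⟨x, y, rfl, -, hy⟩ := exists_eq_append_of_pile_eq (l₂ := []) hl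
  refine ⟨x ++ y, ?_⟩
  rw [List.append_assoc]
  exact pile_append_congr rfl (pile_cons_eq_pile_append_singleton hy)

end Pile

section Reduced

variable {a : Letter N} {i : Fin N} {e : Bool} {u w x : Word N}

theorem not_isChain_pile_of_cancel (hx : ∀ c ∈ x, ¬ Γ.Adj i c.1) :
    ¬ (pile Γ ((i, e) :: x ++ [(i, !e)]) i).IsChain Compatible := by
  intro hchain
  have hne : ∀ s ∈ pile Γ ((i, e) :: x ++ [(i, !e)]) i, s ≠ 0 := by
    rintro _ hs rfl
    obtain ⟨c, hc, hmark⟩ := List.mem_filterMap.1 hs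
    have hadj : ¬ Γ.Adj i c.1 := by
      simp only [List.cons_append, List.mem_cons, List.mem_append, List.not_mem_nil,
        or_false] at hc
      rcases hc with rfl | hc | rfl
      exacts [Γ.irrefl, hx c hc, Γ.irrefl]
    unfold mark at hmark
    split_ifs at hmark with h₁ h₂
    exacts [bead_ne_zero _ (Option.some.inj hmark), hadj h₂.symm]
  have hconst := (hchain.imp_of_mem_imp (S := Eq) fun s t hs ht hst =>
    hst.eq_of_ne_zero (hne s hs) (hne t ht)).pairwise
  rw [List.cons_append, pile_cons_self, pile_append, pile_cons_self, List.pairwise_cons] at hconst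
  exact Bool.not_ne_self e (bead_injective (hconst.1 (bead !e) (by simp))).symm

theorem isReduced_iff_isChain_pile :
    IsReduced Γ w ↔ ∀ k, (pile Γ w k).IsChain Compatible := by
  constructor
  · intro h k
    rw [List.isChain_iff_forall_rel_of_append_cons_cons]
    intro s t l₁ l₂ hl
    by_contra hst
    obtain ⟨e, rfl, rfl⟩ := not_compatible_iff.1 hst
    obtain ⟨u, v, rfl, -, hv⟩ := exists_eq_append_of_pile_eq hl
    obtain ⟨x, y, rfl, hx, -⟩ := exists_eq_append_of_pile_eq (l₁ := []) hv
    exact h ⟨u, x, y, k, e, by simp, fun c hc hadj => pile_eq_nil_iff.1 hx c hc (.inr hadj.symm)⟩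
  · rintro h ⟨u, x, v, i, e, rfl, hx⟩
    have hsub : (i, e) :: x ++ [(i, !e)] <:+: u ++ (i, e) :: x ++ (i, !e) :: v := ⟨u, v, by simp⟩
    exact not_isChain_pile_of_cancel hx ((h i).infix (hsub.filterMap _))

theorem isReduced_congr (h : pile Γ u = pile Γ w) : IsReduced Γ u ↔ IsReduced Γ w := by
  simp only [isReduced_iff_isChain_pile, h]

theorem isReduced_append_singleton_iff :
    IsReduced Γ (w ++ [a]) ↔
      IsReduced Γ w ∧ (pile Γ w a.1).getLast? ≠ some (bead !a.2) := by
  simp only [isReduced_iff_isChain_pile, pile_append, List.isChain_append, forall_and]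
  refine and_congr_right fun _ => ⟨fun h hl => ?_, fun h => ⟨fun k => ?_, fun k s hs t ht => ?_⟩⟩
  · refine not_compatible_iff.2 ⟨!a.2, rfl, congrArg bead (Bool.not_not a.2).symm⟩ ?_
    exact h.2 a.1 _ hl _ (congrArg List.head? (pile_cons_self a.1 a.2 []))
  · rw [pile_singleton]
    cases mark Γ k a <;> simp
  · by_contra hst
    obtain ⟨e, rfl, rfl⟩ := not_compatible_iff.1 hst
    rw [pile_singleton, Option.head?_toList, Option.mem_def] at ht
    obtain rfl := mark_eq_some_bead_iff.1 ht
    exact h (by rwa [Bool.not_not])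

end Reduced

section AddLetter

variable {a b : Letter N} {k : Fin N} {w : Word N} {p : AbstractPiling N}

theorem addLetter_apply_of_not (h : ¬ (k = a.1 ∨ Γ.Adj a.1 k)) : addLetter Γ p a k = p k := by
  unfold addLetter
  split_ifs
  · exact if_neg h
  · rw [not_or] at h
    exact (if_neg h.1).trans (if_neg h.2)

theorem addLetter_pile_of_getLast?_ne (h : (pile Γ w a.1).getLast? ≠ some (bead !a.2)) :
    addLetter Γ (pile Γ w) a = pile Γ (w ++ [a]) := by
  rw [addLetter, neg_bead, if_neg h]
  funext k
  rw [pile_append, pile_singleton, mark]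
  split_ifs <;> simp

theorem addLetter_pile_append_inv (w : Word N) (i : Fin N) (e : Bool) :
    addLetter Γ (pile Γ (w ++ [(i, !e)])) (i, e) = pile Γ w := by
  have hlast : (pile Γ (w ++ [(i, !e)]) i).getLast? = some (bead !e) := by
    rw [pile_append, pile_cons_self]
    exact List.getLast?_concat
  rw [addLetter, neg_bead, if_pos hlast]
  funext k
  rw [pile_append, pile_singleton, mark]
  split_ifs <;> simp_all

theorem exists_isReduced_pile_eq_addLetter (hw : IsReduced Γ w) (a : Letter N) :
    ∃ v, IsReduced Γ v ∧ pile Γ v = addLetter Γ (pile Γ w) a := by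
  by_cases h : (pile Γ w a.1).getLast? = some (bead !a.2)
  · obtain ⟨v, hv⟩ := exists_pile_eq_pile_append_singleton h
    have hred := isReduced_append_singleton_iff.1 ((isReduced_congr hv).1 hw)
    exact ⟨v, hred.1, by rw [hv, addLetter_pile_append_inv]⟩
  · exact ⟨w ++ [a], isReduced_append_singleton_iff.2 ⟨hw, h⟩,
      (addLetter_pile_of_getLast?_ne h).symm⟩

theorem piStar_append_singleton (w : Word N) (a : Letter N) :
    piStar Γ (w ++ [a]) = addLetter Γ (piStar Γ w) a :=
  List.foldl_concat ..

protected theorem IsPiling.addLetter (hp : IsPiling Γ p) (a : Letter N) :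
    IsPiling Γ (addLetter Γ p a) := by
  obtain ⟨w, rfl⟩ := hp
  exact ⟨w ++ [a], piStar_append_singleton w a⟩

theorem IsPiling.exists_isReduced_pile_eq (hp : IsPiling Γ p) :
    ∃ w, IsReduced Γ w ∧ pile Γ w = p := by
  obtain ⟨w, rfl⟩ := hp
  induction w using List.reverseRecOn with
  | nil => exact ⟨[], by simp [IsReduced], rfl⟩
  | append_singleton w a ih =>
    obtain ⟨v, hv, hvw⟩ := ih
    rw [piStar_append_singleton, ← hvw]
    exact exists_isReduced_pile_eq_addLetter hv a

theorem piStar_eq_pile (hw : IsReduced Γ w) : piStar Γ w = pile Γ w := by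
  induction w using List.reverseRecOn with
  | nil => rfl
  | append_singleton w a ih =>
    obtain ⟨hw, ha⟩ := isReduced_append_singleton_iff.1 hw
    rw [piStar_append_singleton, ih hw, addLetter_pile_of_getLast?_ne ha]

theorem IsPiling.addLetter_addLetter_inv (hp : IsPiling Γ p) (i : Fin N) (e : Bool) :
    addLetter Γ (addLetter Γ p (i, e)) (i, !e) = p := by
  obtain ⟨w, hw, rfl⟩ := hp.exists_isReduced_pile_eq
  by_cases h : (pile Γ w i).getLast? = some (bead !e)
  · obtain ⟨v, hv⟩ := exists_pile_eq_pile_append_singleton h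
    have hred := isReduced_append_singleton_iff.1 ((isReduced_congr hv).1 hw)
    rw [hv, addLetter_pile_append_inv, addLetter_pile_of_getLast?_ne hred.2]
  · rw [addLetter_pile_of_getLast?_ne h]
    simpa only [Bool.not_not] using addLetter_pile_append_inv (Γ := Γ) w i !e

theorem exists_pile_eq_addLetter_of_commute (hne : a.1 ≠ b.1) (hab : ¬ Γ.Adj a.1 b.1)
    (w : Word N) :
    ∃ v, addLetter Γ (pile Γ w) a = pile Γ v ∧
      addLetter Γ (pile Γ (w ++ [b])) a = pile Γ (v ++ [b]) := by
  have hb : pile Γ [b] a.1 = [] :=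
    pile_singleton_of_not (not_or.2 ⟨hne, fun hba => hab hba.symm⟩)
  by_cases h : (pile Γ w a.1).getLast? = some (bead !a.2)
  · obtain ⟨v, hv⟩ := exists_pile_eq_pile_append_singleton h
    have hswap : pile Γ (w ++ [b]) = pile Γ ((v ++ [b]) ++ [(a.1, !a.2)]) := by
      rw [pile_append_congr hv rfl, List.append_assoc, List.append_assoc]
      exact pile_append_congr rfl (pile_pair_comm hne hab)
    exact ⟨v, by rw [hv, addLetter_pile_append_inv], by rw [hswap, addLetter_pile_append_inv]⟩
  · refine ⟨w ++ [a], addLetter_pile_of_getLast?_ne h, ?_⟩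
    rw [addLetter_pile_of_getLast?_ne (by rwa [pile_append, hb, List.append_nil]),
      List.append_assoc, List.append_assoc]
    exact pile_append_congr rfl (pile_pair_comm hne hab).symm

theorem addLetter_pile_comm (hne : a.1 ≠ b.1) (hab : ¬ Γ.Adj a.1 b.1) (w : Word N) :
    addLetter Γ (addLetter Γ (pile Γ w) a) b = addLetter Γ (addLetter Γ (pile Γ w) b) a := by
  by_cases h : (pile Γ w b.1).getLast? = some (bead !b.2)
  · obtain ⟨v, hv⟩ := exists_pile_eq_pile_append_singleton h
    obtain ⟨u, hu, hub⟩ :=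
      exists_pile_eq_addLetter_of_commute (b := (b.1, !b.2)) hne hab v
    rw [hv, addLetter_pile_append_inv, hub, addLetter_pile_append_inv, hu]
  · obtain ⟨u, hu, hub⟩ := exists_pile_eq_addLetter_of_commute hne hab w
    have hstack : pile Γ u b.1 = pile Γ w b.1 := by
      rw [← hu, addLetter_apply_of_not (not_or.2 ⟨hne.symm, hab⟩)]
    rw [addLetter_pile_of_getLast?_ne h, hub, hu,
      addLetter_pile_of_getLast?_ne (by rwa [hstack])]

end AddLetter

section Action

variable (Γ) in
/-- The permutation of the set of pilings given by reading a generator. -/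
def readGenerator (i : Fin N) : Equiv.Perm {p : AbstractPiling N // IsPiling Γ p} where
  toFun p := ⟨addLetter Γ p.1 (i, true), p.2.addLetter _⟩
  invFun p := ⟨addLetter Γ p.1 (i, false), p.2.addLetter _⟩
  left_inv p := Subtype.ext (p.2.addLetter_addLetter_inv i true)
  right_inv p := Subtype.ext (p.2.addLetter_addLetter_inv i false)

theorem readGenerator_commute {i j : Fin N} (h : ¬ Γ.Adj i j) :
    Commute (readGenerator Γ i) (readGenerator Γ j) := by
  rcases eq_or_ne i j with rfl | hij
  · rfl
  ext1 ⟨p, hp⟩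
  obtain ⟨w, -, rfl⟩ := hp.exists_isReduced_pile_eq
  exact Subtype.ext (addLetter_pile_comm hij.symm (fun hji => h hji.symm) w)

variable (Γ) in
/-- The right action of the right-angled Artin group on the set of pilings; it takes values in the
opposite group because words are read from left to right. -/
def readHom : ArtinGroup Γ →* (Equiv.Perm {p : AbstractPiling N // IsPiling Γ p})ᵐᵒᵖ :=
  PresentedGroup.toGroup (f := fun i => MulOpposite.op (readGenerator Γ i)) (by
    rintro _ ⟨i, j, hij, rfl⟩
    simp only [map_mul, map_inv, FreeGroup.lift_apply_of]
    rw [(readGenerator_commute hij).op.eq, mul_inv_cancel_right, mul_inv_cancel])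

theorem readHom_toGroup_singleton (a : Letter N) (p : {p : AbstractPiling N // IsPiling Γ p}) :
    ((readHom Γ (toGroup Γ [a])).unop p).1 = addLetter Γ p.1 a := by
  have hgen (i : Fin N) : readHom Γ (toGroup Γ [(i, true)]) = MulOpposite.op (readGenerator Γ i) :=
    PresentedGroup.toGroup.of _
  obtain ⟨i, _ | _⟩ := a
  · rw [toGroup_singleton_false, map_inv, hgen]
    rfl
  · rw [hgen]
    rfl

theorem readHom_toGroup (w : Word N) (p : {p : AbstractPiling N // IsPiling Γ p}) :
    ((readHom Γ (toGroup Γ w)).unop p).1 = w.foldl (addLetter Γ) p.1 := by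
  induction w generalizing p with
  | nil =>
    have hone : toGroup Γ ([] : Word N) = 1 := map_one _
    rw [hone, map_one]
    rfl
  | cons a w ih =>
    rw [← List.singleton_append, toGroup_append, map_mul, MulOpposite.unop_mul,
      Equiv.Perm.mul_apply, ih, readHom_toGroup_singleton]
    rfl

theorem piStar_eq_of_toGroup_eq {u w : Word N} (h : toGroup Γ u = toGroup Γ w) :
    piStar Γ u = piStar Γ w := by
  have hread (v : Word N) := readHom_toGroup v ⟨_, [], rfl⟩ (Γ := Γ)
  exact (hread u).symm.trans (h ▸ hread w)

theorem pile_eq_of_toGroup_eq {u w : Word N} (hu : IsReduced Γ u) (hw : IsReduced Γ w)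
    (h : toGroup Γ u = toGroup Γ w) : pile Γ u = pile Γ w := by
  rw [← piStar_eq_pile hu, ← piStar_eq_pile hw, piStar_eq_of_toGroup_eq h]

end Action

section Greedy

variable {a : Letter N} {u v w : Word N}

variable (Γ) in
/-- A word is greedy if each of its letters has the largest index among the letters that can be
moved to the front of the suffix starting there. These are the words read off by `σ*`. -/
def IsGreedy (w : Word N) : Prop :=
  ∀ a v, a :: v <:+ w → ∀ k ∈ bottom (pile Γ (a :: v)), k ≤ a.1

theorem isGreedy_cons_iff :
    IsGreedy Γ (a :: w) ↔ (∀ k ∈ bottom (pile Γ (a :: w)), k ≤ a.1) ∧ IsGreedy Γ w := by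
  constructor
  · exact fun h => ⟨h a w List.suffix_rfl, fun b v hv => h b v (hv.trans (List.suffix_cons a w))⟩
  · rintro ⟨ha, hw⟩ b v hv
    rcases List.suffix_cons_iff.1 hv with heq | hv
    · obtain ⟨rfl, rfl⟩ := List.cons.inj heq
      exact ha
    · exact hw b v hv

theorem IsGreedy.isNormal (hg : IsGreedy Γ w) (hw : IsReduced Γ w) : IsNormal Γ w := by
  refine ⟨hw, fun v hv => ⟨hw.of_infix hv.isInfix, fun u hu huv a ha b hb => ?_⟩⟩
  obtain ⟨v, rfl⟩ := List.head?_eq_some_iff.1 ha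
  obtain ⟨u, rfl⟩ := List.head?_eq_some_iff.1 hb
  refine hg a v hv b.1 ?_
  rw [← pile_eq_of_toGroup_eq hu (hw.of_infix hv.isInfix) huv]
  exact fst_mem_bottom_pile_cons b u

theorem removeBottom_pile_cons (a : Letter N) (w : Word N) :
    removeBottom Γ (pile Γ (a :: w)) a.1 = pile Γ w := by
  funext k
  rw [removeBottom, ← List.singleton_append, pile_append, pile_singleton, mark]
  split_ifs <;> simp_all

theorem sigmaStar_pile_cons (ha : ∀ k ∈ bottom (pile Γ (a :: w)), k ≤ a.1) :
    sigmaStar Γ (pile Γ (a :: w)) = a :: sigmaStar Γ (pile Γ w) := by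
  have hmem := fst_mem_bottom_pile_cons (Γ := Γ) a w
  have hne : (bottom (pile Γ (a :: w))).Nonempty := ⟨_, hmem⟩
  have hmax : (bottom (pile Γ (a :: w))).max' hne = a.1 :=
    le_antisymm (Finset.max'_le _ _ _ ha) (Finset.le_max' _ _ hmem)
  have hsign : decide ((pile Γ (a :: w) a.1).head? = some 1) = a.2 := by
    rw [pile_cons_self a.1 a.2 w]
    cases a.2 <;> simp [bead]
  rw [sigmaStar, dif_pos hne, hmax, hsign, removeBottom_pile_cons]

theorem IsGreedy.sigmaStar_pile (hg : IsGreedy Γ w) : sigmaStar Γ (pile Γ w) = w := by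
  induction w with
  | nil =>
    have hempty : ¬ (bottom (pile Γ ([] : Word N))).Nonempty := by simp [bottom, pile]
    rw [sigmaStar, dif_neg hempty]
  | cons a w ih =>
    obtain ⟨ha, hw⟩ := isGreedy_cons_iff.1 hg
    rw [sigmaStar_pile_cons ha, ih hw]

theorem exists_isGreedy_pile_eq (w : Word N) : ∃ v, IsGreedy Γ v ∧ pile Γ v = pile Γ w := by
  rcases w with _ | ⟨a, w⟩
  · exact ⟨[], by simp [IsGreedy], rfl⟩
  have hne : (bottom (pile Γ (a :: w))).Nonempty := ⟨_, fst_mem_bottom_pile_cons a w⟩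
  obtain ⟨e, he⟩ := mem_bottom_iff.1 (Finset.max'_mem _ hne)
  obtain ⟨v, _, hv⟩ := exists_pile_eq_pile_cons he
  obtain ⟨u, hu, huv⟩ := exists_isGreedy_pile_eq v
  have hpile := (pile_append_congr (u := [(_, e)]) rfl huv).trans hv.symm
  exact ⟨_, isGreedy_cons_iff.2 ⟨fun k hk => Finset.le_max' _ k (hpile ▸ hk), hu⟩, hpile⟩
termination_by w.length
decreasing_by assumption

theorem IsGreedy.append_comm (hg : IsGreedy Γ (u ++ v))
    (hmin : ∀ k ∈ bottom (pile Γ (u ++ v)), ∀ c ∈ u ++ v, k ≤ c.1) : IsGreedy Γ (v ++ u) := by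
  intro a t ht k hk
  have of_suffix_left (h : a :: t <:+ u) : k ≤ a.1 := by
    obtain ⟨r, rfl⟩ := h
    exact hg a (t ++ v) ⟨r, by simp⟩ k ((mem_bottom_pile_append (u := a :: t)).2 (.inl hk))
  obtain ⟨r, hr⟩ := ht
  rcases List.append_eq_append_iff.1 hr with ⟨s, rfl, hs⟩ | ⟨s, -, hu⟩
  · rcases s with _ | ⟨b, s⟩
    · exact of_suffix_left ⟨[], hs⟩
    obtain ⟨rfl, rfl⟩ := List.cons.inj hs
    rcases (mem_bottom_pile_append (u := a :: s)).1 hk with hk | ⟨-, hk⟩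
    · exact hg a s ⟨u ++ r, by simp⟩ k hk
    · exact hmin k (mem_bottom_pile_append.2 (.inl hk)) a (by simp)
  · exact of_suffix_left ⟨s, hu.symm⟩

theorem IsGreedy.of_isRotated (hg : IsGreedy Γ w)
    (hmin : ∀ k ∈ bottom (pile Γ w), ∀ c ∈ w, k ≤ c.1) (hv : v ~r w) : IsGreedy Γ v := by
  obtain ⟨n, hn, rfl⟩ := List.isRotated_iff_mod.1 hv.symm
  rw [List.rotate_eq_drop_append_take hn]
  apply IsGreedy.append_comm <;> rwa [List.take_append_drop]

end Greedy

section CyclicallyReduced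

variable {v w : Word N}

variable (Γ) in
/-- The stacks of the word, closed up to cycles, have no consecutive opposite signs. This is the
invariant that shows that no sequence of cyclings and commutations leads to a word that is not
reduced. -/
def IsCyclicallyCompatible (w : Word N) : Prop :=
  ∀ k, (pile Γ w k : Cycle SignType).Chain Compatible

theorem IsCyclicallyCompatible.isReduced (hw : IsCyclicallyCompatible Γ w) : IsReduced Γ w := by
  refine isReduced_iff_isChain_pile.2 fun k => ?_
  by_cases h : pile Γ w k = []
  · rw [h]
    exact List.isChain_nil
  · exact ((Cycle.chain_ne_nil _ h).1 (hw k)).tail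

theorem IsReduced.isCyclicallyCompatible (hw : IsReduced Γ w)
    (hc : IsCyclicallyReduced (pile Γ w)) : IsCyclicallyCompatible Γ w := by
  intro k
  by_cases h : pile Γ w k = []
  · rw [h]
    exact Cycle.Chain.nil _
  rw [Cycle.chain_ne_nil _ h, List.isChain_cons]
  refine ⟨fun t ht => ?_, isReduced_iff_isChain_pile.1 hw k⟩
  by_contra hst
  obtain ⟨e, hlast, rfl⟩ := not_compatible_iff.1 hst
  refine hc ⟨k, _, bead_ne_zero _, ht, ?_⟩
  rw [List.getLast?_eq_some_getLast h, hlast, neg_bead, Bool.not_not]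

theorem IsCyclicallyCompatible.move (hv : IsCyclicallyCompatible Γ v) (h : Move Γ v w) :
    IsCyclicallyCompatible Γ w := by
  cases h with
  | cycling a w =>
    intro k
    have hrot : pile Γ ([a] ++ w) k ~r pile Γ (w ++ [a]) k := by
      rw [pile_append, pile_append]
      exact List.isRotated_append
    exact Cycle.coe_eq_coe.2 hrot ▸ hv k
  | commutation u v a b hab =>
    have hne_or : a.1 ≠ b.1 ∨ a = b := by
      by_contra! heq
      have hb : b = (a.1, !a.2) :=
        Prod.ext heq.1.symm (Bool.eq_not.2 fun h => heq.2 (Prod.ext heq.1 h.symm))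
      exact hv.isReduced ⟨u, [], v, a.1, a.2, by simp [hb], by simp⟩
    rcases hne_or with hne | rfl
    · have hpile : pile Γ (u ++ ([a, b] ++ v)) = pile Γ (u ++ ([b, a] ++ v)) :=
        pile_append_congr rfl (pile_append_congr (pile_pair_comm hne hab) rfl)
      exact fun k => congrFun hpile k ▸ hv k
    · exact hv

theorem IsCyclicallyCompatible.isCyclicallyReducedWord (hw : IsCyclicallyCompatible Γ w) :
    IsCyclicallyReducedWord Γ w := by
  intro v hv
  refine IsCyclicallyCompatible.isReduced ?_
  induction hv with
  | refl => exact hw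
  | tail _ h ih => exact ih.move h

end CyclicallyReduced

end RAAG

theorem propositionT {N : ℕ} (Γ : SimpleGraph (Fin N)) [DecidableRel Γ.Adj]
    (p : RAAG.AbstractPiling N) (hp : RAAG.IsPiling Γ p)
    (hns : RAAG.IsNonSplit Γ p) (hcr : RAAG.IsCyclicallyReduced p)
    (hpyr : RAAG.IsPyramidal p) :
    RAAG.IsCyclicNormalForm Γ (RAAG.sigmaStar Γ p) := by
  obtain ⟨w₀, hw₀, rfl⟩ := hp.exists_isReduced_pile_eq
  obtain ⟨w, hg, hw⟩ := RAAG.exists_isGreedy_pile_eq (Γ := Γ) w₀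
  rw [← hw] at hcr hpyr ⊢
  rw [hg.sigmaStar_pile]
  have hred : RAAG.IsReduced Γ w := (RAAG.isReduced_congr hw).2 hw₀
  have hcyc := (hred.isCyclicallyCompatible hcr).isCyclicallyReducedWord
  refine ⟨hred, hcyc, hg.isNormal hred, fun v hv => ?_⟩
  refine (hg.of_isRotated (fun k hk c hc => ?_) hv).isNormal
    (hcyc v (RAAG.reflTransGen_move_of_isRotated hv.symm))
  exact hpyr.le_of_mem_bottom_of_mem_support hk (RAAG.mem_support_pile_iff.2 ⟨c.2, hc⟩)
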